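/- Let $k$ be an algebraically closed field of characteristic $0$, let $K$ be a reductive linear algebraic group over $k$ (a Zariski closed subgroup of some $GL_n(k)$ with trivial unipotent radical, not necessarily connected), and let $G$ be a maximal torus of $K$. Let $V$ be a finite dimensional vector space over $k$ and let $\rho : K \to GL(V)$ be a rational representation. Let $\mathcal{D}(V)$ be the ring of differential operators on the affine space $V$, that is, the subalgebra of $\operatorname{End}_k(\mathcal{O}(V))$ generated by the multiplications by elements of the ring $\mathcal{O}(V)$ of polynomial functions on $V$ and by the derivations of $\mathcal{O}(V)$; in linear coordinates it is the Weyl algebra $k[Q_1,\dots,Q_r,\partial/\partial Q_1,\dots,\partial/\partial Q_r]$. Let $\mathcal{D}(V)^K$ be the subalgebra of those operators that are invariant under the action of $K$ induced by $\rho$. If $0$ is not a weight of $G$ on $V$ (that is, the trivial character of $G$ does not occur in $V$), then $\mathcal{D}(V)^K$ has enough finite dimensional modules: the intersection of the annihilators $\operatorname{ann} M$ over all finite dimensional $\mathcal{D}(V)^K$-modules $M$ is zero. -/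

import Mathlib

open scoped Topology

noncomputable section

namespace InvDiffOps

universe u v

/-! ### Linear algebraic groups

A linear algebraic group over the algebraically closed field `k` is a Zariski closed subgroup
of `GL n k`, identified with its group of `k`-points. -/

section AlgebraicGroups

variable {k : Type u} [Field k]

/-- The coordinate ring of `GL n` over `k`, as a ring of `k`-valued functions: it is generated by
the matrix entries and by the inverse of the determinant. -/
def regularGL (k : Type u) [Field k] (n : ℕ) : Subalgebra k (GL (Fin n) k → k) :=
  Algebra.adjoin k
    (Set.range (fun (p : Fin n × Fin n) (g : GL (Fin n) k) => (g : Matrix _ _ k) p.1 p.2) ∪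
      {fun g : GL (Fin n) k => (Matrix.det (g : Matrix (Fin n) (Fin n) k))⁻¹})

/-- The Zariski topology on `GL n k`: a basis is given by the sets where a regular function does
not vanish. -/
@[reducible] def zariski (k : Type u) [Field k] (n : ℕ) : TopologicalSpace (GL (Fin n) k) :=
  TopologicalSpace.generateFrom {U | ∃ f ∈ regularGL k n, U = {g | f g ≠ 0}}

/-- `H` is a Zariski closed subgroup of `GL n k`, i.e. a linear algebraic group. -/
def IsAlgebraic {n : ℕ} (H : Subgroup (GL (Fin n) k)) : Prop :=
  IsClosed[zariski k n] (H : Set (GL (Fin n) k))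

/-- `H` is connected in the Zariski topology. -/
def IsZariskiConnected {n : ℕ} (H : Subgroup (GL (Fin n) k)) : Prop :=
  @IsConnected _ (zariski k n) (H : Set (GL (Fin n) k))

/-- `f : H → k` is a regular function on the closed subgroup `H` of `GL n k`: it is the
restriction of a regular function on `GL n k`. -/
def IsRegular {n : ℕ} {H : Subgroup (GL (Fin n) k)} (f : H → k) : Prop :=
  ∃ F ∈ regularGL k n, ∀ h : H, f h = F h

/-- All elements of `H` are unipotent. -/
def IsUnipotent {n : ℕ} (H : Subgroup (GL (Fin n) k)) : Prop :=
  ∀ g ∈ H, IsNilpotent ((g : Matrix (Fin n) (Fin n) k) - 1)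

/-- `K` is a reductive linear algebraic group (not necessarily connected): its unipotent radical
is trivial, i.e. the only closed connected unipotent normal subgroup of `K` is the trivial one. -/
structure IsReductive {n : ℕ} (K : Subgroup (GL (Fin n) k)) : Prop where
  isAlgebraic : IsAlgebraic K
  unipotentRadical_trivial : ∀ U : Subgroup (GL (Fin n) k), U ≤ K → (U.subgroupOf K).Normal →
    IsAlgebraic U → IsZariskiConnected U → IsUnipotent U → U = ⊥

/-- The coordinate ring of the torus `(kˣ)^m`, as a ring of functions: the Laurent polynomials in
the `m` coordinates. -/
def regularTorus (k : Type u) [Field k] (m : ℕ) : Subalgebra k ((Fin m → kˣ) → k) :=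
  Algebra.adjoin k
    (Set.range (fun (i : Fin m) (t : Fin m → kˣ) => (t i : k)) ∪
      Set.range (fun (i : Fin m) (t : Fin m → kˣ) => ((t i)⁻¹ : kˣ).val))

/-- `H` is an algebraic torus: a closed subgroup that is isomorphic, as an algebraic group, to
some `(kˣ)^m`. The isomorphism of groups `e` is one of algebraic groups when the functions that
are regular on `H` are exactly those that are regular on `(kˣ)^m` after composition with `e`. -/
structure IsTorus {n : ℕ} (H : Subgroup (GL (Fin n) k)) : Prop where
  isAlgebraic : IsAlgebraic H
  exists_equiv : ∃ (m : ℕ) (e : (Fin m → kˣ) ≃* H),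
    ∀ f : H → k, IsRegular f ↔ f ∘ e ∈ regularTorus k m

/-- `G` is a maximal torus of `K`: a torus contained in `K`, and in no larger torus of `K`. -/
structure IsMaximalTorus {n : ℕ} (K G : Subgroup (GL (Fin n) k)) : Prop where
  le : G ≤ K
  isTorus : IsTorus G
  maximal : ∀ G' : Subgroup (GL (Fin n) k), IsTorus G' → G' ≤ K → G ≤ G' → G' = G

variable {V : Type v} [AddCommGroup V] [Module k V]

/-- The representation `ρ` of the linear algebraic group `H` on `V` is rational, i.e. `H → GL(V)`
is a morphism of algebraic groups: its matrix coefficients are regular functions. -/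
def IsRational {n : ℕ} {H : Subgroup (GL (Fin n) k)} (ρ : Representation k H V) : Prop :=
  ∀ (ξ : Module.Dual k V) (v : V), IsRegular (fun h => ξ (ρ h v))

/-- The character `χ` is a weight of `H` on `V`: it is a regular character of `H`, and there is a
nonzero vector on which `H` acts by `χ`. (The group of characters is written multiplicatively, so
the weight `0` is the character `1`.) -/
def IsWeight {n : ℕ} {H : Subgroup (GL (Fin n) k)} (ρ : Representation k H V) (χ : H →* kˣ) :
    Prop :=
  IsRegular (fun h => (χ h : k)) ∧ ∃ v : V, v ≠ 0 ∧ ∀ h, ρ h v = (χ h : k) • v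

end AlgebraicGroups

/-! ### Differential operators -/

section DiffOps

variable (k : Type u) [Field k] (V : Type v) [AddCommGroup V] [Module k V]

/-- The ring `𝒪(V)` of regular (polynomial) functions on the affine space `V`: the symmetric
algebra of the dual space `V*`, i.e. the polynomial ring in linear coordinates of `V`. -/
abbrev CoordRing : Type (max u v) := SymmetricAlgebra k (Module.Dual k V)

/-- The ring `𝒟(V)` of differential operators on `V`, over a field of characteristic zero: the
algebra of linear endomorphisms of `𝒪(V)` generated by the multiplications by regular functions
and by the derivations of `𝒪(V)`. In linear coordinates `Q₁, …, Qᵣ` of `V` it is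
`k[Q₁, …, Qᵣ, P₁, …, Pᵣ]` with `Pᵢ = ∂/∂Qᵢ`, the Weyl algebra. -/
def diffOps : Subalgebra k (Module.End k (CoordRing k V)) :=
  Algebra.adjoin k
    (Set.range (fun f : CoordRing k V => LinearMap.mulLeft k f) ∪
      Set.range (fun D : Derivation k (CoordRing k V) (CoordRing k V) =>
        (D : CoordRing k V →ₗ[k] CoordRing k V)))

variable {k V} {Γ : Type*} [Group Γ]

/-- The action of a group on `𝒪(V)` by algebra automorphisms induced by a representation on `V`,
`(g • f)(v) = f(g⁻¹ v)`: on linear forms it is the dual representation. -/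
def functionAction (ρ : Representation k Γ V) : Representation k Γ (CoordRing k V) where
  toFun g := (SymmetricAlgebra.lift
    (SymmetricAlgebra.ι k (Module.Dual k V) ∘ₗ ρ.dual g)).toLinearMap
  map_one' := by
    rw [map_one, Module.End.one_eq_id, LinearMap.comp_id, SymmetricAlgebra.lift_ι]
    rfl
  map_mul' g h := by
    rw [Module.End.mul_eq_comp, ← AlgHom.comp_toLinearMap]
    congr 1
    apply SymmetricAlgebra.algHom_ext
    ext ξ
    simp
    rfl

/-- The ring `𝒟(V)^Γ` of invariant differential operators: the `θ` in `𝒟(V)` that are fixed by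
the action `g • θ = g ∘ θ ∘ g⁻¹` of the group. -/
def invDiffOps (ρ : Representation k Γ V) : Subalgebra k (Module.End k (CoordRing k V)) where
  carrier := {θ | θ ∈ diffOps k V ∧ ∀ g, functionAction ρ g * θ * functionAction ρ g⁻¹ = θ}
  mul_mem' := by
    rintro a b ⟨ha, ha'⟩ ⟨hb, hb'⟩
    refine ⟨mul_mem ha hb, fun g => ?_⟩
    have h1 : functionAction ρ g⁻¹ * functionAction ρ g = 1 := by
      rw [← map_mul, inv_mul_cancel, map_one]
    calc functionAction ρ g * (a * b) * functionAction ρ g⁻¹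
        = functionAction ρ g * a * 1 * b * functionAction ρ g⁻¹ := by
          simp only [mul_assoc, one_mul]
      _ = (functionAction ρ g * a * functionAction ρ g⁻¹) *
            (functionAction ρ g * b * functionAction ρ g⁻¹) := by
          rw [← h1]; simp only [mul_assoc]
      _ = a * b := by rw [ha' g, hb' g]
  add_mem' := by
    rintro a b ⟨ha, ha'⟩ ⟨hb, hb'⟩
    refine ⟨add_mem ha hb, fun g => ?_⟩
    rw [mul_add, add_mul, ha' g, hb' g]
  algebraMap_mem' r := by
    refine ⟨(diffOps k V).algebraMap_mem r, fun g => ?_⟩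
    rw [← Algebra.commutes, mul_assoc, ← map_mul, mul_inv_cancel, map_one, mul_one]

end DiffOps

/-- The `k`-algebra `R` has enough finite dimensional modules: the intersection of the
annihilators of all finite dimensional `R`-modules is zero. -/
def HasEnoughFiniteDimensionalModules (k : Type u) [Field k] (R : Type v) [Ring R] [Algebra k R] :
    Prop :=
  ∀ r : R,
    (∀ (M : Type u) [AddCommGroup M] [Module k M] [Module R M] [IsScalarTower k R M]
      [FiniteDimensional k M], r ∈ Module.annihilator R M) → r = 0

end InvDiffOps

end

/-! Since `0` is not a weight, some one-parameter subgroup of the torus pairs nontrivially with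
every weight on `V`. Its value at `2` is an element `g`, diagonal on `V` with eigenvalues `2 ^ c i`,
all `c i ≠ 0` (`exists_basis_eigenvalues_two_zpow`). A `K`-invariant operator commutes with `g`,
which scales the `i`-th coordinate function by `2 ^ (-c i)`.

If all `c i` had the same sign, the eigenspaces of `g` on polynomials would be finite dimensional,
stable under invariant operators, and would span everything. For mixed signs, apply the partial
Fourier transform `xᵢ ↦ ∂ᵢ`, `∂ᵢ ↦ -xᵢ` at the indices with `c i > 0`. It embeds the Weyl algebra
into the operators on polynomials and inverts the scaling factors at those indices. The transformed
invariant operators commute with the scaling by `2 ^ |c i|`; its eigenspaces are the graded pieces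
of the polynomial ring for positive weights, and these are the required modules.

The transform is built as a graph: the algebra generated by the pairs (generator, transformed
generator). Both projections of it are injective, because operators can be normally ordered and a
nonzero normally ordered operator acts nontrivially on polynomials
(`IsWeylPair.eq_zero_of_map_eq_zero`). -/

namespace InvDiffOps

/-! ### Weights of tori and a generic torus element -/

section Torus

variable {k : Type*} [Field k]

/-- The character `t ↦ ∏ tᵢ ^ aᵢ` of the torus `(kˣ)^m`, as a homomorphism to `k`. -/
def torusChar (k : Type*) [Field k] {m : ℕ} (a : Fin m → ℤ) : (Fin m → kˣ) →* k where
  toFun t := ((∏ i, t i ^ a i : kˣ) : k)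
  map_one' := by simp
  map_mul' s t := by simp [mul_zpow, Finset.prod_mul_distrib]

theorem torusChar_apply {m : ℕ} (a : Fin m → ℤ) (t : Fin m → kˣ) :
    torusChar k a t = ((∏ i, t i ^ a i : kˣ) : k) := rfl

theorem torusChar_add {m : ℕ} (a b : Fin m → ℤ) (t : Fin m → kˣ) :
    torusChar k (a + b) t = torusChar k a t * torusChar k b t := by
  simp [torusChar_apply, zpow_add, Finset.prod_mul_distrib]

/-- In characteristic zero the comparison takes place in `ℚ`. Thus `2` has infinite order in `kˣ`,
and a single element can replace a whole one-parameter subgroup. -/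
theorem two_zpow_injective (k : Type*) [Field k] [CharZero k] :
    Function.Injective (fun n : ℤ => (2 : k) ^ n) := by
  intro a b h
  have h' : ((2 : ℚ) ^ a : ℚ) = (2 : ℚ) ^ b := by
    have : (((2 : ℚ) ^ a : ℚ) : k) = (((2 : ℚ) ^ b : ℚ) : k) := by
      push_cast; exact h
    exact_mod_cast this
  exact zpow_right_injective₀ (by norm_num) (by norm_num) h'

theorem torusChar_injective [CharZero k] {m : ℕ} :
    Function.Injective (torusChar k : (Fin m → ℤ) → ((Fin m → kˣ) →* k)) := by
  intro a b h
  funext i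
  have h2 : (2 : k) ≠ 0 := two_ne_zero
  have := DFunLike.congr_fun h (Pi.mulSingle i (Units.mk0 2 h2))
  have key : ∀ c : Fin m → ℤ, torusChar k c (Pi.mulSingle i (Units.mk0 2 h2)) = 2 ^ c i := by
    intro c
    rw [torusChar_apply, Finset.prod_eq_single i]
    · simp
    · intro j _ hj
      simp [Pi.mulSingle_eq_of_ne hj]
    · simp
  rw [key, key] at this
  exact two_zpow_injective k this

theorem linearIndependent_torusChar [CharZero k] {m : ℕ} :
    LinearIndependent k (fun (a : Fin m → ℤ) => (torusChar k a : (Fin m → kˣ) → k)) :=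
  (linearIndependent_monoidHom (Fin m → kˣ) k).comp _ torusChar_injective

/-- The characters form a monoid containing the generators, so the generated algebra is already
their linear span. -/
theorem regularTorus_le_span {m : ℕ} {f : (Fin m → kˣ) → k} (hf : f ∈ regularTorus k m) :
    f ∈ Submodule.span k
      (Set.range fun (a : Fin m → ℤ) => (torusChar k a : (Fin m → kˣ) → k)) := by
  let M : Submonoid ((Fin m → kˣ) → k) :=
    { carrier := Set.range fun (a : Fin m → ℤ) => (torusChar k a : (Fin m → kˣ) → k)
      one_mem' := ⟨0, by funext t; simp [torusChar_apply]⟩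
      mul_mem' := by
        rintro _ _ ⟨a, rfl⟩ ⟨b, rfl⟩
        exact ⟨a + b, by funext t; exact torusChar_add a b t⟩ }
  have hle : Submonoid.closure
      (Set.range (fun (i : Fin m) (t : Fin m → kˣ) => (t i : k)) ∪
      Set.range (fun (i : Fin m) (t : Fin m → kˣ) => ((t i)⁻¹ : kˣ).val)) ≤ M := by
    rw [Submonoid.closure_le]
    rintro _ (⟨i, rfl⟩ | ⟨i, rfl⟩)
    · refine ⟨Pi.single i 1, funext fun t => ?_⟩
      change torusChar k _ t = _
      rw [torusChar_apply, Finset.prod_eq_single i (fun j _ hj => by simp [hj]) (by simp)]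
      simp
    · refine ⟨Pi.single i (-1), funext fun t => ?_⟩
      change torusChar k _ t = _
      rw [torusChar_apply, Finset.prod_eq_single i (fun j _ hj => by simp [hj]) (by simp)]
      simp
  have hf' : f ∈ Subalgebra.toSubmodule (regularTorus k m) := hf
  rw [regularTorus, Algebra.adjoin_eq_span] at hf'
  exact Submodule.span_mono hle hf'

/-- A representation of `(kˣ)^m` whose matrix coefficients are Laurent polynomials is spanned by
weight vectors. -/
theorem span_weightVectors_eq_top [CharZero k] {V : Type*} [AddCommGroup V] [Module k V]
    [FiniteDimensional k V] {m : ℕ} (σ : Representation k (Fin m → kˣ) V)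
    (hσ : ∀ (ξ : Module.Dual k V) (v : V), (fun t => ξ (σ t v)) ∈ regularTorus k m) :
    ⊤ ≤ Submodule.span k {w : V | ∃ a : Fin m → ℤ, ∀ t, σ t w = torusChar k a t • w} := by
  intro v _
  let b := Module.finBasis k V
  -- Expand each coordinate of `t ↦ σ t v` in characters; collecting the coefficients of the
  -- character `a` gives the candidate weight component `w a` of `v`.
  have h1 : ∀ l, ∃ c : (Fin m → ℤ) →₀ k,
      (c.sum fun a x => x • (torusChar k a : (Fin m → kˣ) → k)) = fun t => b.coord l (σ t v) :=
    fun l => Finsupp.mem_span_range_iff_exists_finsupp.1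
      (regularTorus_le_span (hσ (b.coord l) v))
  choose c hc using h1
  let S : Finset (Fin m → ℤ) := Finset.univ.biUnion fun l => (c l).support
  let w : (Fin m → ℤ) → V := fun a => ∑ l, c l a • b l
  have hc' : ∀ l t, ∑ a ∈ S, c l a * torusChar k a t = b.coord l (σ t v) := by
    intro l t
    rw [← congrFun (hc l) t, Finsupp.sum_of_support_subset (s := S) _ _ _ (by simp)]
    · simp [Finset.sum_apply]
    · exact Finset.subset_biUnion_of_mem (fun l => (c l).support) (Finset.mem_univ l)
  have hv : ∀ t, σ t v = ∑ a ∈ S, torusChar k a t • w a := by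
    intro t
    rw [← b.sum_repr (σ t v)]
    simp only [w, Finset.smul_sum]
    rw [Finset.sum_comm]
    refine Finset.sum_congr rfl fun l _ => ?_
    have := hc' l t
    rw [Module.Basis.coord_apply] at this
    rw [← this, Finset.sum_smul]
    exact Finset.sum_congr rfl fun a _ => by rw [smul_smul, mul_comm]
  -- Compute `σ s (σ t v)` in two ways and compare the coefficients of each character of `t`; linear
  -- functionals `ξ` reduce this to independence of scalar functions.
  have hw : ∀ a ∈ S, ∀ s, σ s (w a) = torusChar k a s • w a := by
    intro a ha s
    rw [← sub_eq_zero, ← Module.forall_dual_apply_eq_zero_iff k]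
    intro ξ
    let x : (Fin m → ℤ) → k := fun a => ξ (σ s (w a) - torusChar k a s • w a)
    have hx : ∑ a ∈ S, x a • (torusChar k a : (Fin m → kˣ) → k) = 0 → x a = 0 := fun h =>
      linearIndependent_iff'.1 (linearIndependent_torusChar (k := k) (m := m)) S x h a ha
    apply hx
    funext t
    have e1 : σ s (σ t v) = ∑ a ∈ S, torusChar k a t • σ s (w a) := by
      rw [hv t, map_sum]
      simp
    have e2 : σ s (σ t v) = ∑ a ∈ S, torusChar k a t • (torusChar k a s • w a) := by
      rw [← Module.End.mul_apply, ← map_mul, hv]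
      exact Finset.sum_congr rfl fun a _ => by rw [map_mul, smul_smul, mul_comm]
    have e3 : ∑ a ∈ S, torusChar k a t • (σ s (w a) - torusChar k a s • w a) = 0 := by
      simp only [smul_sub, Finset.sum_sub_distrib]
      rw [← e1, ← e2, sub_self]
    have e4 := congrArg ξ e3
    rw [map_sum, map_zero] at e4
    rw [Finset.sum_apply, Pi.zero_apply, ← e4]
    refine Finset.sum_congr rfl fun a _ => ?_
    rw [map_smul, smul_eq_mul, mul_comm, Pi.smul_apply, smul_eq_mul]
  have : v = ∑ a ∈ S, torusChar k a 1 • w a := by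
    rw [← hv 1, map_one]; rfl
  rw [this]
  exact Submodule.sum_mem _ fun a ha =>
    Submodule.smul_mem _ _ (Submodule.subset_span ⟨a, hw a ha⟩)

/-- Finitely many nonzero integer vectors are all nonzero on some integral linear form. -/
theorem exists_forall_sum_mul_ne_zero {ι : Type*} [Fintype ι] {m : ℕ} (a : ι → Fin m → ℤ)
    (ha : ∀ i, a i ≠ 0) : ∃ n : Fin m → ℤ, ∀ i, ∑ j, a i j * n j ≠ 0 := by
  -- Encode each vector as a polynomial. An integer `N` that is a root of none of them gives the
  -- linear form with coefficients `N ^ j`.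
  let p : ι → Polynomial ℤ := fun i => ∑ j : Fin m, Polynomial.monomial (j : ℕ) (a i j)
  have hp : ∀ i, p i ≠ 0 := by
    intro i h
    apply ha i
    funext j
    have := congrArg (Polynomial.coeff · (j : ℕ)) h
    simpa [p, Polynomial.finsetSum_coeff, Polynomial.coeff_monomial, Fin.val_inj] using this
  obtain ⟨N, hN⟩ := Polynomial.exists_eval_ne_zero_of_natDegree_lt_card (∏ i, p i)
    (Finset.prod_ne_zero_iff.2 fun i _ => hp i)
    (by rw [Cardinal.mk_int]; exact Cardinal.natCast_lt_aleph0)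
  refine ⟨fun j => N ^ (j : ℕ), fun i h => hN ?_⟩
  rw [Polynomial.eval_prod]
  refine Finset.prod_eq_zero (Finset.mem_univ i) ?_
  simpa [p, Polynomial.eval_finsetSum] using h

/-- A torus in a linear algebraic group without the weight zero on a rational representation
contains an element that is diagonalizable with eigenvalues nontrivial powers of two. -/
theorem exists_basis_eigenvalues_two_zpow [CharZero k] {V : Type*} [AddCommGroup V] [Module k V]
    [FiniteDimensional k V] {n : ℕ} {K G : Subgroup (GL (Fin n) k)} (hle : G ≤ K)
    (hG : IsTorus G) (ρ : Representation k K V) (hρ : IsRational ρ)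
    (h0 : ¬ IsWeight (ρ.comp (Subgroup.inclusion hle)) 1) :
    ∃ (g : K) (r : ℕ) (b : Module.Basis (Fin r) k V) (c : Fin r → ℤ),
      (∀ i, c i ≠ 0) ∧ ∀ i, ρ g (b i) = (2 : k) ^ c i • b i := by
  obtain ⟨m, e, he⟩ := hG.exists_equiv
  let τ : (Fin m → kˣ) →* K := (Subgroup.inclusion hle).comp e.toMonoidHom
  let σ : Representation k (Fin m → kˣ) V := ρ.comp τ
  have hσ : ∀ (ξ : Module.Dual k V) (v : V), (fun t => ξ (σ t v)) ∈ regularTorus k m := by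
    intro ξ v
    obtain ⟨F, hF, hF'⟩ := hρ ξ v
    exact (he fun h => ξ (ρ (Subgroup.inclusion hle h) v)).1 ⟨F, hF, fun h => hF' _⟩
  have hspan := span_weightVectors_eq_top σ hσ
  let B := Module.Basis.ofSpan hspan
  let b : Module.Basis (Fin (Module.finrank k V)) k V :=
    B.reindex (B.indexEquiv (Module.finBasis k V))
  have hb : ∀ i, ∃ a : Fin m → ℤ, ∀ t, σ t (b i) = torusChar k a t • b i := by
    intro i
    have hmem : b i ∈ Set.range B := ⟨_, (B.reindex_apply _ i).symm⟩
    exact Module.Basis.ofSpan_subset hspan hmem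
  choose a ha using hb
  -- A zero exponent vector would make `b i` a nonzero vector fixed by `G`, that is, a vector of
  -- weight zero.
  have ha0 : ∀ i, a i ≠ 0 := by
    intro i hi
    refine h0 ⟨⟨1, one_mem _, fun h => by simp⟩, b i, b.ne_zero i, fun h => ?_⟩
    have := ha i (e.symm h)
    simpa [σ, τ, hi, torusChar_apply] using this
  obtain ⟨N, hN⟩ := exists_forall_sum_mul_ne_zero a ha0
  -- The value at `2` of the one-parameter subgroup with exponents `N`.
  let t : Fin m → kˣ := fun j => Units.mk0 (2 : k) two_ne_zero ^ N j
  refine ⟨τ t, _, b, fun i => ∑ j, a i j * N j, hN, fun i => ?_⟩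
  have ht : torusChar k (a i) t = (2 : k) ^ (∑ j, a i j * N j) := by
    rw [torusChar_apply, ← Units.val_mk0 (two_ne_zero : (2 : k) ≠ 0), ← Units.val_zpow_eq_zpow_val,
      Units.val_inj]
    have hsum : ∀ (u : kˣ) (s : Finset (Fin m)) (f : Fin m → ℤ),
        u ^ (∑ j ∈ s, f j) = ∏ j ∈ s, u ^ f j := fun u s f => by
      induction s using Finset.cons_induction with
      | empty => simp
      | cons j s hj ih => rw [Finset.sum_cons, Finset.prod_cons, zpow_add, ih]
    rw [hsum]
    exact Finset.prod_congr rfl fun j _ => by rw [← zpow_mul, mul_comm]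
  exact (ha i t).trans (by rw [ht])

end Torus
end InvDiffOps

namespace InvDiffOps

/-! ### Weyl pairs, normal ordering and faithfulness -/

section Weyl

open MvPolynomial

variable {k : Type*} [Field k] {I : Type*}

/-- The families `X` and `Y` satisfy the canonical commutation relations. -/
structure IsWeylPair [DecidableEq I] {B : Type*} [Ring B] (X Y : I → B) : Prop where
  commX : ∀ i j, X i * X j = X j * X i
  commY : ∀ i j, Y i * Y j = Y j * Y i
  commYX : ∀ i j, Y i * X j = X j * Y i + if i = j then 1 else 0

-- Since `B` need not be commutative, the evaluation is made in the commutative subalgebra generated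
-- by the `x i`.
open scoped IsMulCommutative in
theorem exists_mvPolynomial_algHom {B : Type*} [Ring B] [Algebra k B] (x : I → B)
    (h : ∀ i j, x i * x j = x j * x i) :
    ∃ ψ : MvPolynomial I k →ₐ[k] B, ∀ i, ψ (X i) = x i := by
  have hc := Algebra.isMulCommutative_adjoin k (s := Set.range x) (by
    rintro _ ⟨i, rfl⟩ _ ⟨j, rfl⟩
    exact h i j)
  exact ⟨(Algebra.adjoin k (Set.range x)).val.comp
    (aeval fun i => ⟨x i, Algebra.subset_adjoin ⟨i, rfl⟩⟩), fun i => by simp⟩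

/-- Multiplication by the `i`-th coordinate. -/
noncomputable def coordOp (k : Type*) [Field k] {I : Type*} (i : I) : Module.End k (MvPolynomial I k) :=
  LinearMap.mulLeft k (X i)

/-- The `i`-th partial derivative, as a linear operator. -/
noncomputable def derivOp (k : Type*) [Field k] {I : Type*} (i : I) : Module.End k (MvPolynomial I k) :=
  (pderiv i : Derivation k (MvPolynomial I k) (MvPolynomial I k))

theorem coordOp_apply (i : I) (f : MvPolynomial I k) : coordOp k i f = X i * f := rfl

theorem derivOp_apply (i : I) (f : MvPolynomial I k) : derivOp k i f = pderiv i f := rfl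

/-- The constant `c` is a product of falling factorials of the exponents, nonzero in characteristic
zero exactly when `b ≤ a`. The claim is additive in `b`, so single derivatives suffice. The
subtraction `a - b` is truncated, harmlessly, as `c = 0` when `b ≤ a` fails. -/
theorem exists_iterated_derivOp_monomial [CharZero k]
    (D : MvPolynomial I k →ₐ[k] Module.End k (MvPolynomial I k))
    (hD : ∀ i, D (X i) = derivOp k i) (b : I →₀ ℕ) : ∀ a : I →₀ ℕ, ∃ c : k,
      D (monomial b 1) (monomial a 1) = monomial (a - b) c ∧ (b ≤ a → c ≠ 0) ∧
        (¬ b ≤ a → c = 0) := by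
  have hadd : ∀ b₁ b₂ : I →₀ ℕ,
      (∀ a : I →₀ ℕ, ∃ c : k, D (monomial b₁ 1) (monomial a 1) = monomial (a - b₁) c ∧
        (b₁ ≤ a → c ≠ 0) ∧ (¬ b₁ ≤ a → c = 0)) →
      (∀ a : I →₀ ℕ, ∃ c : k, D (monomial b₂ 1) (monomial a 1) = monomial (a - b₂) c ∧
        (b₂ ≤ a → c ≠ 0) ∧ (¬ b₂ ≤ a → c = 0)) →
      ∀ a : I →₀ ℕ, ∃ c : k, D (monomial (b₁ + b₂) 1) (monomial a 1) =
        monomial (a - (b₁ + b₂)) c ∧ (b₁ + b₂ ≤ a → c ≠ 0) ∧ (¬ b₁ + b₂ ≤ a → c = 0) := by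
    intro b₁ b₂ h₁ h₂ a
    obtain ⟨c₂, e₂, n₂, z₂⟩ := h₂ a
    obtain ⟨c₁, e₁, n₁, z₁⟩ := h₁ (a - b₂)
    refine ⟨c₂ * c₁, ?_, fun h => ?_, fun h => ?_⟩
    · have : (monomial (b₁ + b₂) (1 : k)) = monomial b₁ 1 * monomial b₂ 1 := by
        rw [monomial_mul, one_mul]
      rw [this, map_mul, Module.End.mul_apply, e₂, 
        show monomial (a - b₂) c₂ = c₂ • monomial (a - b₂) (1 : k) by
          rw [smul_monomial, smul_eq_mul, mul_one],
        map_smul, e₁, smul_monomial, tsub_tsub, add_comm b₂, smul_eq_mul]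
    · have h2 : b₂ ≤ a := le_trans (by simp) h
      exact mul_ne_zero (n₂ h2) (n₁ ((le_tsub_iff_right h2).2 h))
    · by_cases h2 : b₂ ≤ a
      · rw [z₁ (fun h1 => h ((le_tsub_iff_right h2).1 h1)), mul_zero]
      · rw [z₂ h2, zero_mul]
  have hzero : ∀ a : I →₀ ℕ, ∃ c : k, D (monomial 0 1) (monomial a 1) = monomial (a - 0) c ∧
      (0 ≤ a → c ≠ 0) ∧ (¬ 0 ≤ a → c = 0) := fun a =>
    ⟨1, by rw [← one_def, map_one]; simp, by simp, by simp⟩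
  induction b using Finsupp.induction_linear with
  | zero => exact hzero
  | add b₁ b₂ h₁ h₂ => exact hadd b₁ b₂ h₁ h₂
  | single i n =>
    induction n with
    | zero => rw [Finsupp.single_zero]; exact hzero
    | succ n ih =>
      rw [Finsupp.single_add]
      refine hadd _ _ ih fun a => ⟨a i, ?_, fun h => ?_, fun h => ?_⟩
      · rw [← X, hD, derivOp_apply, pderiv_monomial, one_mul]
      · have := h i
        rw [Finsupp.single_eq_same] at this
        exact_mod_cast (by omega : a i ≠ 0)
      · rw [Finsupp.single_le_iff] at h
        exact_mod_cast (by omega : a i = 0)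

variable [DecidableEq I]

theorem isWeylPair_coordOp_derivOp :
    IsWeylPair (coordOp k : I → Module.End k (MvPolynomial I k)) (derivOp k) where
  commX i j := LinearMap.ext fun f => mul_left_comm (X i) (X j) f
  commY i j := by
    have h : ⁅(pderiv i : Derivation k (MvPolynomial I k) (MvPolynomial I k)),
        (pderiv j : Derivation k (MvPolynomial I k) (MvPolynomial I k))⁆ = 0 := by
      refine derivation_ext fun l => ?_
      rw [Derivation.commutator_apply, pderiv_X, pderiv_X]
      by_cases h1 : j = l <;> by_cases h2 : i = l <;> simp [h1, h2]
    refine LinearMap.ext fun f => ?_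
    have := DFunLike.congr_fun h f
    rw [Derivation.commutator_apply, Derivation.zero_apply, sub_eq_zero] at this
    exact this
  commYX i j := by
    refine LinearMap.ext fun f => ?_
    by_cases h : i = j
    · subst h; simp [coordOp_apply, derivOp_apply]
    · simp [coordOp_apply, derivOp_apply, h, pderiv_X_of_ne (Ne.symm h)]

namespace IsWeylPair

variable {B : Type*} [Ring B] [Algebra k B] {x y : I → B}

/-- Normal ordering. -/
theorem adjoin_le_span (h : IsWeylPair x y) {ψx ψy : MvPolynomial I k →ₐ[k] B}
    (hx : ∀ i, ψx (X i) = x i) (hy : ∀ i, ψy (X i) = y i) {z : B}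
    (hz : z ∈ Algebra.adjoin k (Set.range x ∪ Set.range y)) :
    ∃ F : (I →₀ ℕ) →₀ MvPolynomial I k, z = F.sum fun b f => ψx f * ψy (monomial b 1) := by
  let N : Submodule k B :=
    Submodule.span k {w | ∃ (f : MvPolynomial I k) (b : I →₀ ℕ), w = ψx f * ψy (monomial b 1)}
  -- The commutator of `y i` with a polynomial in the `x j` is its derivative, so left
  -- multiplication by `y i` preserves the normally ordered span.
  have hcomm : ∀ i f, y i * ψx f = ψx f * y i + ψx (pderiv i f) := by
    intro i f
    induction f using MvPolynomial.induction_on with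
    | C a =>
      rw [pderiv_C, map_zero, add_zero, ← algebraMap_eq, AlgHom.commutes]
      exact (Algebra.commutes a (y i)).symm
    | add p q hp hq => rw [map_add, mul_add, hp, hq, map_add, map_add, add_mul]; abel
    | mul_X p j hp =>
      rw [map_mul, hx, ← mul_assoc, hp, add_mul, mul_assoc, h.commYX, mul_add, pderiv_mul,
        pderiv_X, map_add, map_mul, map_mul, hx, mul_assoc]
      by_cases hij : i = j
      · subst hij; simp; abel
      · simp [hij]
  have hgen : Set.range x ∪ Set.range y ⊆ {z | ∀ w ∈ N, z * w ∈ N} := by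
    rintro _ (⟨i, rfl⟩ | ⟨i, rfl⟩) w hw
    · induction hw using Submodule.span_induction with
      | mem w hw =>
        obtain ⟨f, b, rfl⟩ := hw
        exact Submodule.subset_span ⟨X i * f, b, by rw [map_mul, hx, mul_assoc]⟩
      | zero => simp
      | add u v _ _ hu hv => rw [mul_add]; exact add_mem hu hv
      | smul a u _ hu => rw [mul_smul_comm]; exact N.smul_mem a hu
    · induction hw using Submodule.span_induction with
      | mem w hw =>
        obtain ⟨f, b, rfl⟩ := hw
        rw [← mul_assoc, hcomm, add_mul, mul_assoc, ← hy, ← map_mul, X, monomial_mul, one_mul]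
        exact add_mem (Submodule.subset_span ⟨_, _, rfl⟩) (Submodule.subset_span ⟨_, _, rfl⟩)
      | zero => simp
      | add u v _ _ hu hv => rw [mul_add]; exact add_mem hu hv
      | smul a u _ hu => rw [mul_smul_comm]; exact N.smul_mem a hu
  have hmul : ∀ w ∈ N, z * w ∈ N := by
    induction hz using Algebra.adjoin_induction with
    | mem z hz => exact hgen hz
    | algebraMap a => intro w hw; rw [← Algebra.smul_def]; exact N.smul_mem a hw
    | add u v _ _ hu hv => intro w hw; rw [add_mul]; exact add_mem (hu w hw) (hv w hw)
    | mul u v _ _ hu hv => intro w hw; rw [mul_assoc]; exact hu _ (hv w hw)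
  have hzN : z ∈ N := by
    rw [← mul_one z]
    exact hmul 1 (Submodule.subset_span ⟨1, 0, by rw [← one_def, map_one, map_one, one_mul]⟩)
  clear hmul hz
  induction hzN using Submodule.span_induction with
  | mem w hw =>
    obtain ⟨f, b, rfl⟩ := hw
    exact ⟨Finsupp.single b f, by rw [Finsupp.sum_single_index]; simp⟩
  | zero => exact ⟨0, by simp⟩
  | add u v _ _ hu hv =>
    obtain ⟨F, rfl⟩ := hu
    obtain ⟨F', rfl⟩ := hv
    exact ⟨F + F', by
      rw [Finsupp.sum_add_index' (by simp) (by simp [add_mul])]⟩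
  | smul a u _ hu =>
    obtain ⟨F, rfl⟩ := hu
    exact ⟨a • F, by
      rw [Finsupp.sum_smul_index' (by simp), Finsupp.smul_sum]
      simp⟩

/-- The algebra generated by a Weyl pair acts faithfully on polynomials, whenever it acts by
coordinates and partial derivatives. -/
theorem eq_zero_of_map_eq_zero [CharZero k] (h : IsWeylPair x y)
    (φ : B →ₐ[k] Module.End k (MvPolynomial I k)) (hφx : ∀ i, φ (x i) = coordOp k i)
    (hφy : ∀ i, φ (y i) = derivOp k i) {z : B}
    (hz : z ∈ Algebra.adjoin k (Set.range x ∪ Set.range y)) (hφz : φ z = 0) : z = 0 := by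
  obtain ⟨ψx, hx⟩ := exists_mvPolynomial_algHom (k := k) x h.commX
  obtain ⟨ψy, hy⟩ := exists_mvPolynomial_algHom (k := k) y h.commY
  obtain ⟨F, rfl⟩ := h.adjoin_le_span hx hy hz
  suffices hF : F = 0 by simp [hF]
  by_contra hF
  have hmul : ∀ f g, φ (ψx f) g = f * g := by
    intro f g
    have : φ.comp ψx = Algebra.lmul k (MvPolynomial I k) := by
      refine algHom_ext fun i => ?_
      rw [AlgHom.comp_apply, hx, hφx]; rfl
    exact DFunLike.congr_fun (DFunLike.congr_fun this f) g
  -- Apply the operator to the monomial of exponent `b`, with `b` of minimal degree in the support.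
  -- Any other `b'` in the support would need `b' ≤ b` to contribute, and minimality then forces `b'
  -- = b`. What survives is `F b` times a nonzero constant.
  obtain ⟨b, hb, hmin⟩ := F.support.exists_min_image (fun b => b.degree)
    (Finsupp.support_nonempty_iff.2 hF)
  have key := fun b' => exists_iterated_derivOp_monomial (φ.comp ψy)
    (fun i => by rw [AlgHom.comp_apply, hy, hφy]) b' b
  have h0 : φ (F.sum fun b f => ψx f * ψy (monomial b 1)) (monomial b 1) = 0 := by
    rw [hφz]; rfl
  rw [Finsupp.sum, map_sum, LinearMap.sum_apply, Finset.sum_eq_single b] at h0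
  · rw [map_mul, Module.End.mul_apply, hmul] at h0
    obtain ⟨c, e, n, -⟩ := key b
    rw [AlgHom.comp_apply] at e
    rw [e, mul_eq_zero, monomial_eq_zero] at h0
    exact h0.elim (Finsupp.mem_support_iff.1 hb) (n le_rfl)
  · intro b' hb' hne
    obtain ⟨c, e, -, z⟩ := key b'
    rw [AlgHom.comp_apply] at e
    rw [map_mul, Module.End.mul_apply, e, z, map_zero, map_zero]
    intro hle
    refine hne (le_antisymm hle ?_)
    have h1 : b'.degree + (b - b').degree = b.degree := by
      rw [← map_add, add_tsub_cancel_of_le hle]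
    have h2 : (b - b').degree = 0 := by have := hmin b' hb'; omega
    rw [Finsupp.degree_eq_zero_iff, tsub_eq_zero_iff_le] at h2
    exact h2
  · intro hb'
    exact absurd hb hb'

end IsWeylPair

end Weyl
end InvDiffOps

namespace InvDiffOps

/-! ### The partial Fourier transform as a graph -/

section Fourier

open MvPolynomial

variable {k : Type*} [Field k] {I : Type*}

namespace IsWeylPair

variable [DecidableEq I] {B : Type*} [Ring B] {x y : I → B}

/-- The substitution `(x, y) ↦ (y, -x)` at the indices in `s` is symplectic, hence preserves the
commutation relations. -/
theorem twist (h : IsWeylPair x y) (s : I → Prop) [DecidablePred s] :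
    IsWeylPair (fun i => if s i then y i else x i) (fun i => if s i then -x i else y i) where
  commX i j := by
    have := h.commX i j
    have := h.commY i j
    have := h.commYX i j
    have := h.commYX j i
    by_cases hij : i = j
    · subst hij; rfl
    · split_ifs <;> simp_all [Ne.symm hij]
  commY i j := by
    have := h.commX i j
    have := h.commY i j
    have := h.commYX i j
    have := h.commYX j i
    by_cases hij : i = j
    · subst hij; rfl
    · split_ifs <;> simp_all [Ne.symm hij]
  commYX i j := by
    have := h.commX i j
    have := h.commY i j
    have h1 := h.commYX i j
    have h2 := h.commYX j i
    by_cases hij : i = j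
    · subst hij
      rw [if_pos rfl] at h2
      by_cases hi : s i
      · simp [hi, h2]
      · simpa [hi] using h2
    · split_ifs <;> simp_all [Ne.symm hij]

theorem prod {B' : Type*} [Ring B'] {x' y' : I → B'} (h : IsWeylPair x y)
    (h' : IsWeylPair x' y') :
    IsWeylPair (fun i => (x i, x' i)) (fun i => (y i, y' i)) where
  commX i j := Prod.ext (h.commX i j) (h'.commX i j)
  commY i j := Prod.ext (h.commY i j) (h'.commY i j)
  commYX i j := by
    refine Prod.ext ((h.commYX i j).trans ?_) ((h'.commYX i j).trans ?_) <;>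
    split_ifs <;> rfl

end IsWeylPair

/-- The Weyl algebra, as an algebra of operators on polynomials. -/
noncomputable def weylAlgebra (k : Type*) [Field k] (I : Type*) :
    Subalgebra k (Module.End k (MvPolynomial I k)) :=
  Algebra.adjoin k (Set.range (coordOp k) ∪ Set.range (derivOp k))

section Twisted

variable (k) (s : I → Prop) [DecidablePred s]

/-- The `i`-th coordinate, paired with its partial Fourier transform along `s`. -/
noncomputable def coordPair (i : I) :
    Module.End k (MvPolynomial I k) × Module.End k (MvPolynomial I k) :=
  (coordOp k i, if s i then derivOp k i else coordOp k i)

/-- The `i`-th partial derivative, paired with its partial Fourier transform along `s`. -/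
noncomputable def derivPair (i : I) :
    Module.End k (MvPolynomial I k) × Module.End k (MvPolynomial I k) :=
  (derivOp k i, if s i then -coordOp k i else derivOp k i)

/-- The graph of the partial Fourier transform along `s` of the Weyl algebra. -/
noncomputable def fourierGraph :
    Subalgebra k (Module.End k (MvPolynomial I k) × Module.End k (MvPolynomial I k)) :=
  Algebra.adjoin k (Set.range (coordPair k s) ∪ Set.range (derivPair k s))

theorem isWeylPair_coordPair_derivPair [DecidableEq I] :
    IsWeylPair (coordPair k s) (derivPair k s) :=
  isWeylPair_coordOp_derivOp.prod (isWeylPair_coordOp_derivOp.twist s)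

variable {k s}

theorem fourierGraph_eq_zero_of_fst [CharZero k]
    {z : Module.End k (MvPolynomial I k) × Module.End k (MvPolynomial I k)}
    (hz : z ∈ fourierGraph k s) (h : z.1 = 0) : z = 0 := by
  classical
  exact (isWeylPair_coordPair_derivPair k s).eq_zero_of_map_eq_zero (AlgHom.fst k _ _)
    (fun _ => rfl) (fun _ => rfl) hz h

/-- The twist has order dividing four, so three twists undo it. The generators `x'`, `y'` obtained
this way generate the graph and have second components the plain coordinates and derivatives, so the
second projection is faithful too. -/
theorem fourierGraph_eq_zero_of_snd [CharZero k]
    {z : Module.End k (MvPolynomial I k) × Module.End k (MvPolynomial I k)}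
    (hz : z ∈ fourierGraph k s) (h : z.2 = 0) : z = 0 := by
  classical
  let x' := fun i => if s i then -derivPair k s i else coordPair k s i
  let y' := fun i => if s i then coordPair k s i else derivPair k s i
  have hw : IsWeylPair x' y' := by
    convert (((isWeylPair_coordPair_derivPair k s).twist s).twist s).twist s using 1 <;>
    · funext i
      by_cases hi : s i <;> simp [x', y', hi]
  have hle : fourierGraph k s ≤ Algebra.adjoin k (Set.range x' ∪ Set.range y') := by
    refine Algebra.adjoin_le ?_
    have hx : ∀ i, x' i ∈ Algebra.adjoin k (Set.range x' ∪ Set.range y') := fun i =>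
      Algebra.subset_adjoin (Or.inl ⟨i, rfl⟩)
    have hy : ∀ i, y' i ∈ Algebra.adjoin k (Set.range x' ∪ Set.range y') := fun i =>
      Algebra.subset_adjoin (Or.inr ⟨i, rfl⟩)
    rintro _ (⟨i, rfl⟩ | ⟨i, rfl⟩)
    · by_cases hi : s i
      · simpa [y', hi] using hy i
      · simpa [x', hi] using hx i
    · by_cases hi : s i
      · simpa [x', hi] using neg_mem (hx i)
      · simpa [y', hi] using hy i
  refine hw.eq_zero_of_map_eq_zero (AlgHom.snd k _ _) (fun i => ?_) (fun i => ?_) (hle hz) h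
  · by_cases hi : s i <;> simp [x', hi, coordPair, derivPair]
  · by_cases hi : s i <;> simp [y', hi, coordPair, derivPair]

theorem map_fst_fourierGraph :
    (fourierGraph k s).map (AlgHom.fst k _ _) = weylAlgebra k I := by
  rw [fourierGraph, AlgHom.map_adjoin, Set.image_union, ← Set.range_comp, ← Set.range_comp]
  rfl

/-- The partial Fourier transform is a well-defined injective homomorphism on the Weyl
algebra. -/
theorem exists_partialFourier (k : Type*) [Field k] [CharZero k] (s : I → Prop)
    [DecidablePred s] :
    ∃ Φ : weylAlgebra k I →ₐ[k] Module.End k (MvPolynomial I k), Function.Injective Φ ∧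
      ∀ z : weylAlgebra k I, ((z : Module.End k (MvPolynomial I k)), Φ z) ∈ fourierGraph k s := by
  -- The first projection identifies the graph with the Weyl algebra; the transform is the second
  -- projection after the inverse of `p`.
  let p : fourierGraph k s →ₐ[k] weylAlgebra k I :=
    ((AlgHom.fst k _ _).comp (fourierGraph k s).val).codRestrict _ fun z => by
      rw [← map_fst_fourierGraph (s := s)]
      exact ⟨z, z.2, rfl⟩
  have hp : Function.Bijective p := by
    constructor
    · rw [injective_iff_map_eq_zero]
      intro z hz
      exact Subtype.ext (fourierGraph_eq_zero_of_fst z.2 (congrArg Subtype.val hz))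
    · rintro ⟨z, hz⟩
      rw [← map_fst_fourierGraph (s := s)] at hz
      obtain ⟨w, hw, rfl⟩ := hz
      exact ⟨⟨w, hw⟩, rfl⟩
  let E := AlgEquiv.ofBijective p hp
  have hE : ∀ z, (E.symm z).1.1 = z.1 := fun z =>
    congrArg Subtype.val (E.apply_symm_apply z)
  refine ⟨((AlgHom.snd k _ _).comp (fourierGraph k s).val).comp E.symm.toAlgHom, ?_, fun z => ?_⟩
  · rw [injective_iff_map_eq_zero]
    intro z hz
    have h0 := fourierGraph_eq_zero_of_snd (E.symm z).2 hz
    exact Subtype.ext ((hE z).symm.trans (congrArg Prod.fst h0))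
  · convert (E.symm z).2 using 1
    exact Prod.ext (hE z).symm rfl

end Twisted

/-! ### Scalings and their eigenspaces -/

section Scaling

/-- The algebra endomorphism that scales the `i`-th coordinate by `q i`. -/
noncomputable def scaling (q : I → k) : MvPolynomial I k →ₐ[k] MvPolynomial I k :=
  aeval fun i => q i • X i

theorem scaling_X (q : I → k) (i : I) : scaling q (X i) = q i • X i := by
  rw [scaling, aeval_X]

theorem scaling_monomial (q : I → k) (m : I →₀ ℕ) (a : k) :
    scaling q (monomial m a) = monomial m ((m.prod fun i n => q i ^ n) * a) := by
  rw [scaling, aeval_monomial, algebraMap_eq, Finsupp.prod]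
  simp only [smul_eq_C_mul, mul_pow]
  rw [Finset.prod_mul_distrib]
  simp only [← C_pow]
  rw [← map_prod C, ← mul_assoc, ← C_mul, monomial_eq (s := m), mul_comm a]
  rfl

theorem coeff_scaling (q : I → k) (m : I →₀ ℕ) (f : MvPolynomial I k) :
    coeff m (scaling q f) = (m.prod fun i n => q i ^ n) * coeff m f := by
  classical
  induction f using MvPolynomial.induction_on' with
  | monomial u a =>
    rw [scaling_monomial, coeff_monomial, coeff_monomial]
    split_ifs with h
    · rw [h]
    · rw [mul_zero]
  | add p q hp hq => rw [map_add, coeff_add, hp, hq, coeff_add, mul_add]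

theorem scaling_mul_scaling_inv {q : I → k} (hq : ∀ i, q i ≠ 0) :
    (scaling q).toLinearMap * (scaling q⁻¹).toLinearMap = 1 := by
  have : (scaling q).comp (scaling q⁻¹) = AlgHom.id k _ := by
    refine algHom_ext fun i => ?_
    rw [AlgHom.comp_apply, scaling_X, map_smul, scaling_X, smul_smul, Pi.inv_apply,
      inv_mul_cancel₀ (hq i), one_smul, AlgHom.id_apply]
  exact congrArg AlgHom.toLinearMap this

theorem scaling_mul_coordOp (q : I → k) (i : I) :
    (scaling q).toLinearMap * coordOp k i = (q i • coordOp k i) * (scaling q).toLinearMap := by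
  refine LinearMap.ext fun f => ?_
  simp [coordOp_apply, scaling_X]

theorem scaling_mul_neg_coordOp (q : I → k) (i : I) :
    (scaling q).toLinearMap * -coordOp k i = (q i • -coordOp k i) * (scaling q).toLinearMap := by
  refine LinearMap.ext fun f => ?_
  simp [coordOp_apply, scaling_X]

theorem scaling_mul_derivOp {q : I → k} (hq : ∀ i, q i ≠ 0) (i : I) :
    (scaling q).toLinearMap * derivOp k i =
      ((q i)⁻¹ • derivOp k i) * (scaling q).toLinearMap := by
  classical
  refine LinearMap.ext fun f => ?_
  change scaling q (pderiv i f) = (q i)⁻¹ • pderiv i (scaling q f)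
  induction f using MvPolynomial.induction_on with
  | C a => simp [scaling]
  | add p q hp hq => simp only [map_add, hp, hq, smul_add]
  | mul_X p j hp =>
    rw [pderiv_mul, map_add, map_mul, hp, map_mul, map_mul, scaling_X, pderiv_mul,
      Derivation.map_smul, pderiv_X]
    by_cases hij : i = j
    · subst hij
      simp [smul_smul, mul_inv_cancel₀ (hq i), inv_mul_cancel₀ (hq i)]
    · simp [Pi.single_eq_of_ne (Ne.symm hij), smul_comm (q j)]

/-- Coordinates and derivatives scale inversely, so exchanging them at `i` replaces `q i` by its
inverse. Conjugation by the pair of scalings `γ` therefore preserves the graph; it fixes the first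
component of `z`, hence all of `z`, as the first projection is injective. -/
theorem commute_scaling_of_mem_fourierGraph [CharZero k] {s : I → Prop} [DecidablePred s]
    {q : I → k} (hq : ∀ i, q i ≠ 0)
    {z : Module.End k (MvPolynomial I k) × Module.End k (MvPolynomial I k)}
    (hz : z ∈ fourierGraph k s) (h : Commute z.1 (scaling q).toLinearMap) :
    Commute z.2 (scaling fun i => if s i then (q i)⁻¹ else q i).toLinearMap := by
  set q' : I → k := fun i => if s i then (q i)⁻¹ else q i with hq'
  have hq0 : ∀ i, q' i ≠ 0 := fun i => by
    by_cases hi : s i <;> simp [hq', hi, hq]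
  let γ : Module.End k (MvPolynomial I k) × Module.End k (MvPolynomial I k) :=
    ((scaling q).toLinearMap, (scaling q').toLinearMap)
  have hconj : ∀ z ∈ fourierGraph k s, ∃ w ∈ fourierGraph k s, γ * z = w * γ := by
    intro z hz
    induction hz using Algebra.adjoin_induction with
    | mem z hz =>
      rcases hz with ⟨i, rfl⟩ | ⟨i, rfl⟩
      · refine ⟨q i • coordPair k s i, Subalgebra.smul_mem (fourierGraph k s)
          (Algebra.subset_adjoin (Or.inl ⟨i, rfl⟩)) _, Prod.ext (scaling_mul_coordOp q i) ?_⟩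
        by_cases hi : s i
        · simpa [hq', γ, coordPair, hi] using scaling_mul_derivOp hq0 i
        · simpa [hq', γ, coordPair, hi] using scaling_mul_coordOp q' i
      · refine ⟨(q i)⁻¹ • derivPair k s i, Subalgebra.smul_mem (fourierGraph k s)
          (Algebra.subset_adjoin (Or.inr ⟨i, rfl⟩)) _, Prod.ext (scaling_mul_derivOp hq i) ?_⟩
        by_cases hi : s i
        · have hqi : q' i = (q i)⁻¹ := if_pos hi
          have hd : (derivPair k s i).2 = -coordOp k i := if_pos hi
          have e := scaling_mul_neg_coordOp q' i
          rwa [hqi, ← hd] at e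
        · simpa [hq', γ, derivPair, hi] using scaling_mul_derivOp hq0 i
    | algebraMap a =>
      exact ⟨algebraMap k _ a, Subalgebra.algebraMap_mem _ a, (Algebra.commutes a γ).symm⟩
    | add u v _ _ hu hv =>
      obtain ⟨u', hu', eu⟩ := hu
      obtain ⟨v', hv', ev⟩ := hv
      exact ⟨u' + v', add_mem hu' hv', by rw [mul_add, eu, ev, add_mul]⟩
    | mul u v _ _ hu hv =>
      obtain ⟨u', hu', eu⟩ := hu
      obtain ⟨v', hv', ev⟩ := hv
      exact ⟨u' * v', mul_mem hu' hv', by rw [← mul_assoc, eu, mul_assoc, ev, mul_assoc]⟩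
  obtain ⟨w, hw, e⟩ := hconj z hz
  have h1 : w.1 = z.1 := by
    have e1 : z.1 * (scaling q).toLinearMap = w.1 * (scaling q).toLinearMap :=
      h.eq.trans (congrArg Prod.fst e)
    have := congrArg (· * (scaling q⁻¹).toLinearMap) e1
    simpa only [mul_assoc, scaling_mul_scaling_inv hq, mul_one] using this.symm
  have h2 : w = z := sub_eq_zero.1
    (fourierGraph_eq_zero_of_fst (sub_mem hw hz) (sub_eq_zero.2 h1))
  rw [h2] at e
  exact (congrArg Prod.snd e).symm

/-- The eigenspaces of a scaling by positive powers of two. -/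
noncomputable def scalingEigenspace (k : Type*) [Field k] (d : I → ℕ) (N : ℕ) :
    Submodule k (MvPolynomial I k) :=
  Module.End.eigenspace (scaling fun i => (2 : k) ^ d i).toLinearMap ((2 : k) ^ N)

theorem prod_two_pow (d : I → ℕ) (m : I →₀ ℕ) :
    (m.prod fun i n => ((2 : k) ^ d i) ^ n) = 2 ^ (m.sum fun i n => d i * n) := by
  rw [Finsupp.sum, ← Finset.prod_pow_eq_pow_sum]
  exact Finset.prod_congr rfl fun i _ => (pow_mul _ _ _).symm

theorem monomial_mem_scalingEigenspace (d : I → ℕ) (m : I →₀ ℕ) (a : k) :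
    monomial m a ∈ scalingEigenspace k d (m.sum fun i n => d i * n) := by
  rw [scalingEigenspace, Module.End.mem_eigenspace_iff]
  rw [AlgHom.toLinearMap_apply, scaling_monomial, prod_two_pow, smul_monomial, smul_eq_mul]

theorem iSup_scalingEigenspace (d : I → ℕ) : ⨆ N, scalingEigenspace k d N = ⊤ := by
  rw [eq_top_iff]
  intro f _
  rw [f.as_sum]
  exact Submodule.sum_mem _ fun m _ =>
    (le_iSup (scalingEigenspace k d) _) (monomial_mem_scalingEigenspace d m _)

/-- Only monomials of weighted degree `N` occur; as all weights are at least one, their total degree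
is at most `N`. -/
theorem finiteDimensional_scalingEigenspace [Finite I] [CharZero k] {d : I → ℕ}
    (hd : ∀ i, d i ≠ 0) (N : ℕ) : FiniteDimensional k (scalingEigenspace k d N) := by
  have hle : scalingEigenspace k d N ≤ restrictTotalDegree I k N := by
    intro f hf
    rw [scalingEigenspace, Module.End.mem_eigenspace_iff, AlgHom.toLinearMap_apply] at hf
    rw [mem_restrictTotalDegree]
    refine Finset.sup_le fun m hm => ?_
    have h1 := congrArg (coeff m) hf
    rw [coeff_scaling, prod_two_pow, coeff_smul, smul_eq_mul] at h1
    have h2 := mul_right_cancel₀ (mem_support_iff.1 hm) h1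
    have h3 : (m.sum fun i n => d i * n) = N := by
      exact_mod_cast two_zpow_injective k (a₁ := ((m.sum fun i n => d i * n : ℕ) : ℤ))
        (a₂ := (N : ℤ)) (by simpa only [zpow_natCast] using h2)
    rw [← h3]
    exact Finset.sum_le_sum fun i _ => Nat.le_mul_of_pos_left _ (Nat.pos_of_ne_zero (hd i))
  exact Submodule.finiteDimensional_of_le hle

end Scaling

end Fourier
end InvDiffOps

namespace InvDiffOps

/-! ### Invariant operators in eigencoordinates -/

section Main

open MvPolynomial

universe u v

/-- An algebra acting faithfully on a space that is the sum of finite dimensional invariant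
subspaces has enough finite dimensional modules. -/
theorem hasEnough_of_faithful {k : Type u} [Field k] {R : Type v} [Ring R] [Algebra k R]
    {P : Type u} [AddCommGroup P] [Module k P] (Ψ : R →ₐ[k] Module.End k P)
    (hΨ : Function.Injective Ψ) {J : Type*} (E : J → Submodule k P)
    (hfin : ∀ j, FiniteDimensional k (E j)) (hinv : ∀ r j, ∀ f ∈ E j, Ψ r f ∈ E j)
    (htop : ⨆ j, E j = ⊤) : HasEnoughFiniteDimensionalModules k R := by
  intro r hr
  apply hΨ
  rw [map_zero]
  have hE : ∀ j, E j ≤ LinearMap.ker (Ψ r) := by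
    intro j f hf
    let φ : R →+* Module.End k (E j) :=
      { toFun := fun r => (Ψ r).restrict (hinv r j)
        map_one' := by ext f; simp
        map_mul' := fun a b => by ext f; simp
        map_zero' := by ext f; simp
        map_add' := fun a b => by ext f; simp }
    let _ : Module R (E j) := Module.compHom (E j) φ
    have hsmul : ∀ (a : R) (f : E j), ((a • f : E j) : P) = Ψ a f := fun a f => rfl
    have : IsScalarTower k R (E j) := ⟨fun a b f => Subtype.ext (by
      rw [hsmul, map_smul, Submodule.coe_smul, hsmul]; rfl)⟩
    have := Module.mem_annihilator.1 (hr (E j)) ⟨f, hf⟩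
    exact congrArg Subtype.val this
  have : (⊤ : Submodule k P) ≤ LinearMap.ker (Ψ r) := htop ▸ iSup_le hE
  exact LinearMap.ker_eq_top.1 (top_le_iff.1 this)

variable {k : Type u} [Field k]

theorem mulLeft_mem_weylAlgebra {I : Type*} (f : MvPolynomial I k) :
    LinearMap.mulLeft k f ∈ weylAlgebra k I := by
  change Algebra.lmul k (MvPolynomial I k) f ∈ weylAlgebra k I
  induction f using MvPolynomial.induction_on with
  | C a => rw [← algebraMap_eq, AlgHom.commutes]; exact Subalgebra.algebraMap_mem _ a
  | add p q hp hq => rw [map_add]; exact add_mem hp hq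
  | mul_X p i hp => rw [map_mul]; exact mul_mem hp (Algebra.subset_adjoin (Or.inl ⟨i, rfl⟩))

theorem derivation_mem_weylAlgebra {I : Type*} [Fintype I]
    (D : Derivation k (MvPolynomial I k) (MvPolynomial I k)) :
    (D : Module.End k (MvPolynomial I k)) ∈ weylAlgebra k I := by
  classical
  -- A derivation is determined by its values on the coordinates.
  have hD : D = ∑ i, D (X i) • (pderiv i : Derivation k (MvPolynomial I k) _) := by
    refine derivation_ext fun j => ?_
    rw [← Derivation.coeFnAddMonoidHom_apply (∑ i, _), map_sum, Finset.sum_apply,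
      Finset.sum_eq_single j]
    · simp
    · intro i _ hij
      simp [pderiv_X_of_ne (Ne.symm hij)]
    · simp
  have hD' : (D : Module.End k (MvPolynomial I k)) =
      ∑ i, LinearMap.mulLeft k (D (X i)) * derivOp k i := by
    refine LinearMap.ext fun f => ?_
    rw [LinearMap.sum_apply]
    conv_lhs => rw [hD]
    change (∑ i, D (X i) • (pderiv i : Derivation k (MvPolynomial I k) _)) f = _
    rw [← Derivation.coeFnAddMonoidHom_apply (∑ i, _), map_sum, Finset.sum_apply]
    rfl
  rw [hD']
  exact sum_mem fun i _ =>
    mul_mem (mulLeft_mem_weylAlgebra _) (Algebra.subset_adjoin (Or.inr ⟨i, rfl⟩))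

variable {V : Type v} [AddCommGroup V] [Module k V]

/-- In linear coordinates, differential operators are elements of the Weyl algebra. -/
theorem conj_mem_weylAlgebra {I : Type*} [Fintype I]
    (ε : CoordRing k V ≃ₐ[k] MvPolynomial I k) {θ : Module.End k (CoordRing k V)}
    (hθ : θ ∈ diffOps k V) : ε.toLinearEquiv.conjAlgEquiv k θ ∈ weylAlgebra k I := by
  induction hθ using Algebra.adjoin_induction with
  | mem θ hθ =>
    rcases hθ with ⟨f, rfl⟩ | ⟨D, rfl⟩
    · convert mulLeft_mem_weylAlgebra (ε f) using 1
      refine LinearMap.ext fun g => ?_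
      simp [LinearEquiv.conjAlgEquiv_apply]
    · let D' : Derivation k (MvPolynomial I k) (MvPolynomial I k) :=
        Derivation.mk' (ε.toLinearEquiv.conjAlgEquiv k (D : _ →ₗ[k] _)) fun a b => by
          simp [LinearEquiv.conjAlgEquiv_apply]
      exact derivation_mem_weylAlgebra D'
  | algebraMap a => rw [AlgEquiv.commutes]; exact Subalgebra.algebraMap_mem _ a
  | add u v _ _ hu hv => rw [map_add]; exact add_mem hu hv
  | mul u v _ _ hu hv => rw [map_mul]; exact mul_mem hu hv

/-- In coordinates with respect to an eigenbasis, the action on functions is a scaling. -/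
theorem conj_functionAction {Γ : Type*} [Group Γ] {I : Type*} [Finite I] [DecidableEq I]
    (ρ : Representation k Γ V) (b : Module.Basis I k V) (g : Γ) (q : I → k)
    (hb : ∀ i, ρ g⁻¹ (b i) = q i • b i) :
    (SymmetricAlgebra.equivMvPolynomial b.dualBasis).toLinearEquiv.conjAlgEquiv k
      (functionAction ρ g) = (scaling q).toLinearMap := by
  have hdual : ∀ i, ρ.dual g (b.dualBasis i) = q i • b.dualBasis i := by
    intro i
    refine b.ext fun j => ?_
    rw [Representation.dual_apply, Module.Dual.transpose_apply, LinearMap.comp_apply, hb,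
      map_smul, LinearMap.smul_apply]
    by_cases hij : i = j
    · rw [hij]
    · simp [Ne.symm hij]
  have : ((SymmetricAlgebra.equivMvPolynomial b.dualBasis).toAlgHom.comp
      (SymmetricAlgebra.lift (SymmetricAlgebra.ι k (Module.Dual k V) ∘ₗ ρ.dual g))).comp
      (SymmetricAlgebra.equivMvPolynomial b.dualBasis).symm.toAlgHom = scaling q := by
    refine algHom_ext fun i => ?_
    rw [scaling_X, AlgHom.comp_apply, AlgHom.comp_apply]
    change SymmetricAlgebra.equivMvPolynomial b.dualBasis (SymmetricAlgebra.lift _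
      ((SymmetricAlgebra.equivMvPolynomial b.dualBasis).symm (X i))) = _
    rw [SymmetricAlgebra.equivMvPolynomial_symm_X, SymmetricAlgebra.lift_ι_apply,
      LinearMap.comp_apply, hdual, map_smul, map_smul,
      SymmetricAlgebra.equivMvPolynomial_ι_apply]
  exact congrArg AlgHom.toLinearMap this

/-- If a group acts on `V` and contains an element that is diagonalizable with eigenvalues
nontrivial powers of two, then the invariant differential operators have enough finite dimensional
modules. -/
theorem hasEnough_invDiffOps_of_eigenbasis [CharZero k] {Γ : Type*} [Group Γ]
    (ρ : Representation k Γ V) (g : Γ) {r : ℕ} (b : Module.Basis (Fin r) k V) (c : Fin r → ℤ)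
    (hc : ∀ i, c i ≠ 0) (hb : ∀ i, ρ g (b i) = (2 : k) ^ c i • b i) :
    HasEnoughFiniteDimensionalModules k (invDiffOps ρ) := by
  have h2 : (2 : k) ≠ 0 := two_ne_zero
  let ε := SymmetricAlgebra.equivMvPolynomial b.dualBasis
  -- The exponent changes sign because `g` acts on functions through `g⁻¹`.
  let q : Fin r → k := fun i => (2 : k) ^ (-c i)
  have hq : ∀ i, q i ≠ 0 := fun i => zpow_ne_zero _ h2
  have hb' : ∀ i, ρ g⁻¹ (b i) = q i • b i := by
    intro i
    have h1 : ρ g⁻¹ (ρ g (b i)) = b i := by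
      rw [← Module.End.mul_apply, ← map_mul, inv_mul_cancel, map_one]; rfl
    rw [hb, map_smul] at h1
    rw [← h1, smul_smul, h1, ← zpow_add₀ h2, neg_add_cancel, zpow_zero, one_smul]
  -- Transform exactly where `q i = 2 ^ (-c i)` has negative exponent; all factors then become `2 ^
  -- d i` with `d i = |c i| > 0`.
  obtain ⟨Φ, hΦ, hgraph⟩ := exists_partialFourier k fun i : Fin r => 0 < c i
  let conj := ε.toLinearEquiv.conjAlgEquiv k
  -- Polynomials in `Fin r` variables live in the universe of `k`, where the test modules are taken,
  -- whatever the universe of `V`.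
  let Ψ : invDiffOps ρ →ₐ[k] Module.End k (MvPolynomial (Fin r) k) :=
    Φ.comp ((conj.toAlgHom.comp (invDiffOps ρ).val).codRestrict _ fun θ =>
      conj_mem_weylAlgebra ε θ.2.1)
  have hΨ : Function.Injective Ψ := by
    refine hΦ.comp fun θ θ' h => Subtype.ext (conj.injective (congrArg Subtype.val h))
  let d : Fin r → ℕ := fun i => (c i).natAbs
  have hd : ∀ i, d i ≠ 0 := fun i => Int.natAbs_ne_zero.2 (hc i)
  have hscale : (fun i => if 0 < c i then (q i)⁻¹ else q i) = fun i => (2 : k) ^ d i := by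
    funext i
    simp only [q, d]
    split_ifs with h
    · rw [← zpow_neg, neg_neg, ← zpow_natCast, Int.natAbs_of_nonneg h.le]
    · rw [← zpow_natCast, Int.ofNat_natAbs_of_nonpos (not_lt.1 h)]
  refine hasEnough_of_faithful Ψ hΨ (scalingEigenspace k d)
    (finiteDimensional_scalingEigenspace hd) (fun θ N f hf => ?_) (iSup_scalingEigenspace d)
  have hcomm : Commute (conj θ) (scaling q).toLinearMap := by
    rw [← conj_functionAction ρ b g q hb']
    have h1 : Commute (θ : Module.End k (CoordRing k V)) (functionAction ρ g) := by
      have h3 : functionAction ρ g⁻¹ * functionAction ρ g = 1 := by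
        rw [← map_mul, inv_mul_cancel, map_one]
      have h4 := congrArg (· * functionAction ρ g) (θ.2.2 g)
      simp only [mul_assoc, h3, mul_one] at h4
      exact h4.symm
    exact h1.map conj
  have hcomm' : Commute (Ψ θ) (scaling fun i => (2 : k) ^ d i).toLinearMap := by
    have := commute_scaling_of_mem_fourierGraph hq (hgraph ⟨conj θ, conj_mem_weylAlgebra ε θ.2.1⟩) hcomm
    rw [hscale] at this
    exact this
  exact Module.End.mapsTo_genEigenspace_of_comm hcomm'.symm _ _ hf

end Main
end InvDiffOps

theorem theoremD {k : Type*} [Field k] [IsAlgClosed k] [CharZero k]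
    {V : Type*} [AddCommGroup V] [Module k V] [FiniteDimensional k V]
    {n : ℕ} (K G : Subgroup (GL (Fin n) k))
    (hK : InvDiffOps.IsReductive K) (hG : InvDiffOps.IsMaximalTorus K G)
    (ρ : Representation k K V) (hρ : InvDiffOps.IsRational ρ)
    (h0 : ¬ InvDiffOps.IsWeight (ρ.comp (Subgroup.inclusion hG.le)) 1) :
    InvDiffOps.HasEnoughFiniteDimensionalModules k (InvDiffOps.invDiffOps ρ) := by
  obtain ⟨g, r, b, c, hc, hb⟩ :=
    InvDiffOps.exists_basis_eigenvalues_two_zpow hG.le hG.isTorus ρ hρ h0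
  exact InvDiffOps.hasEnough_invDiffOps_of_eigenbasis ρ g b c hc hb
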